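/- Notation. A Stirling permutation of order $n$ is a word $\sigma=\sigma_1\sigma_2\cdots\sigma_{2n}$ that is a permutation of the multiset $\{1,1,2,2,\ldots,n,n\}$ such that for each $i\in\{1,\ldots,n\}$ all entries between the two occurrences of $i$ are larger than $i$; $\mathcal{Q}_n$ is the set of these words ($\mathcal{Q}_0$ consists of the empty word). Let $\mathrm{ap}(\sigma)$ be the number of ascent-plateaus of $\sigma$, i.e. of indices $i\in\{2,\ldots,2n-1\}$ with $\sigma_{i-1}<\sigma_i=\sigma_{i+1}$. The flag ascent-plateau number is $\mathrm{fap}(\sigma)=2\,\mathrm{ap}(\sigma)+1$ if $\sigma_1=\sigma_2$, and $\mathrm{fap}(\sigma)=2\,\mathrm{ap}(\sigma)$ otherwise (so it is $0$ for the empty word). Put $$T_n(x)=\sum_{\sigma\in\mathcal{Q}_n}x^{\mathrm{fap}(\sigma)},\qquad M_n(x)=\sum_{\sigma\in\mathcal{Q}_n}x^{\mathrm{ap}(\sigma)}.$$ Let $B_n$ be the hyperoctahedral group, i.e. the group of permutations $\pi$ of $\{\pm1,\ldots,\pm n\}$ with $\pi(-i)=-\pi(i)$ for all $i$. For $\pi\in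 B_n$ let $\mathrm{des}_A(\pi)=\#\{i\in\{1,\ldots,n-1\}:\pi(i)>\pi(i+1)\}$, and let $\mathrm{fdes}(\pi)=2\,\mathrm{des}_A(\pi)+1$ if $\pi(1)<0$, and $\mathrm{fdes}(\pi)=2\,\mathrm{des}_A(\pi)$ otherwise. Let $D$ be the formal derivative on $\mathbb{Q}[[x,y,z]]$ with respect to the context-free grammar $x\to xyz$, $y\to yz^2$, $z\to y^2z$, i.e. the derivation $D=xyz\,\partial_x+yz^2\,\partial_y+y^2z\,\partial_z$. Theorem. Let $n\ge 1$. Then $\mathrm{fap}(\sigma)\le 2n$ for all $\sigma\in\mathcal{Q}_n$, and $$D^n(x)=x\sum_{\sigma\in\mathcal{Q}_n}y^{\mathrm{fap}(\sigma)}z^{2n-\mathrm{fap}(\sigma)}.$$ Moreover, as polynomials in $x$, $$\sum_{\pi\in B_n}x^{\mathrm{fdes}(\pi)}=\sum_{k=0}^n\binom{n}{k}\,T_k(x)\,M_{n-k}(x^2).$$ -/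

import Mathlib

namespace FlagAscentPlateau

/-! ## Context-free grammars and their formal derivatives -/

/-- The formal derivative of the context-free grammar `G : A → ℚ⟦A⟧` over a finite alphabet `A`:
the derivation of `ℚ⟦A⟧` (with its usual extension to infinite sums of monomials) that sends
every letter `a` to `G a`, that is `f ↦ ∑ a, G a * ∂f/∂a`. -/
noncomputable def formalDerivative {A : Type} [Fintype A] (G : A → MvPowerSeries A ℚ) :
    Derivation ℚ (MvPowerSeries A ℚ) (MvPowerSeries A ℚ) :=
  ∑ a : A, G a • MvPowerSeries.pderiv ℚ a

theorem formalDerivative_X {A : Type} [Fintype A] (G : A → MvPowerSeries A ℚ) (a : A) :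
    formalDerivative G (MvPowerSeries.X a) = G a := by
  classical
  have h : ∀ s : Finset A, (∑ b ∈ s, G b • MvPowerSeries.pderiv ℚ b) (MvPowerSeries.X a) =
      ∑ b ∈ s, G b * MvPowerSeries.pderiv ℚ b (MvPowerSeries.X a) := by
    intro s
    induction s using Finset.induction_on with
    | empty => simp
    | insert b s hb ih => simp [Finset.sum_insert hb, ih]
  simp [formalDerivative, h, MvPowerSeries.pderiv_X, Pi.single_apply]

/-- The alphabet `{x, y, z}`. -/
inductive Letter
  | x
  | y
  | z
  deriving DecidableEq

instance : Fintype Letter :=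
  ⟨⟨[Letter.x, Letter.y, Letter.z], by simp⟩, fun a => by cases a <;> simp⟩

/-- The letter `x` as an element of `ℚ⟦x, y, z⟧`. -/
noncomputable def lx : MvPowerSeries Letter ℚ := MvPowerSeries.X Letter.x

/-- The letter `y` as an element of `ℚ⟦x, y, z⟧`. -/
noncomputable def ly : MvPowerSeries Letter ℚ := MvPowerSeries.X Letter.y

/-- The letter `z` as an element of `ℚ⟦x, y, z⟧`. -/
noncomputable def lz : MvPowerSeries Letter ℚ := MvPowerSeries.X Letter.z

/-- The grammar `x → xyz`, `y → yz²`, `z → y²z`. -/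
noncomputable def flagGrammar : Letter → MvPowerSeries Letter ℚ
  | Letter.x => lx * ly * lz
  | Letter.y => ly * lz ^ 2
  | Letter.z => ly ^ 2 * lz

/-! ## Stirling permutations -/

/-- All entries of the word `σ` that lie between two occurrences of `i` are larger than `i`. -/
def IsStirling (σ : List ℕ) : Prop :=
  ∀ k < σ.length, ∀ j < k, ∀ i < j, σ.getD i 0 = σ.getD k 0 → σ.getD i 0 < σ.getD j 0

instance : DecidablePred IsStirling := fun σ => by
  unfold IsStirling
  infer_instance

/-- The set `Q_n` of Stirling permutations of order `n`: arrangements of the multiset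
`{1, 1, 2, 2, …, n, n}` that satisfy the Stirling condition. -/
def stirlingPerms (n : ℕ) : Finset (List ℕ) :=
  (Multiset.lists ((Finset.Icc 1 n).val + (Finset.Icc 1 n).val)).toFinset.filter IsStirling

/-- The number of ascent-plateaus `σ_{i-1} < σ_i = σ_{i+1}`, `2 ≤ i ≤ 2n - 1`. List positions
start at `0`, so `σ_{i-1}`, `σ_i`, `σ_{i+1}` are the entries at `j`, `j + 1`, `j + 2` for
`j = i - 2`. -/
def ap (σ : List ℕ) : ℕ :=
  ((Finset.range (σ.length - 2)).filter fun j =>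
    σ.getD j 0 < σ.getD (j + 1) 0 ∧ σ.getD (j + 1) 0 = σ.getD (j + 2) 0).card

/-- The flag ascent-plateau number: `2 ap(σ) + 1` if `σ₁ = σ₂`, and `2 ap(σ)` otherwise
(so it is `0` for the empty word). -/
def fap (σ : List ℕ) : ℕ :=
  if 2 ≤ σ.length ∧ σ.getD 0 0 = σ.getD 1 0 then 2 * ap σ + 1 else 2 * ap σ

/-! ## Signed permutations -/

/-- The set `±[n] = {±1, …, ±n}`. -/
abbrev PM (n : ℕ) : Type := {k : ℤ // k ∈ (Finset.Icc (-(n : ℤ)) n).erase 0}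

instance (n : ℕ) : Neg (PM n) :=
  ⟨fun k => ⟨-k.1, by
    have h := k.2
    simp only [Finset.mem_erase, Finset.mem_Icc, ne_eq] at h ⊢
    omega⟩⟩

/-- The hyperoctahedral group `B_n` of signed permutations of `±[n]`. -/
def hyperoctahedral (n : ℕ) : Subgroup (Equiv.Perm (PM n)) where
  carrier := {π | ∀ i, π (-i) = -π i}
  mul_mem' := by
    intro a b ha hb i
    change a (b (-i)) = -a (b i)
    rw [hb, ha]
  one_mem' := fun _ => rfl
  inv_mem' := by
    intro a ha i
    change a.symm (-i) = -a.symm i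
    rw [Equiv.symm_apply_eq, ha, Equiv.apply_symm_apply]

noncomputable instance (n : ℕ) : DecidablePred (· ∈ hyperoctahedral n) := fun π =>
  inferInstanceAs (Decidable (∀ i, π (-i) = -π i))

/-- The `i`-th entry `π(i)` of the word of `π`, for `1 ≤ i ≤ n` (and `0` for other `i`). -/
noncomputable def entry {n : ℕ} (π : Equiv.Perm (PM n)) (i : ℕ) : ℤ :=
  if h : (i : ℤ) ∈ (Finset.Icc (-(n : ℤ)) n).erase 0 then (π ⟨i, h⟩).1 else 0

/-- The number of `i ∈ {1, …, n - 1}` with `π(i) > π(i + 1)`. -/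
noncomputable def desA {n : ℕ} (π : Equiv.Perm (PM n)) : ℕ :=
  ((Finset.Ico 1 n).filter fun i => entry π i > entry π (i + 1)).card

/-- The flag descent number: `2 des_A(π) + 1` if `π(1) < 0`, and `2 des_A(π)` otherwise. -/
noncomputable def fdes {n : ℕ} (π : Equiv.Perm (PM n)) : ℕ :=
  if entry π 1 < 0 then 2 * desA π + 1 else 2 * desA π

/-! ## The enumerative polynomials -/

/-- The flag descent polynomial `F_n(x) = ∑_{π ∈ B_n} x^{fdes(π)}`. -/
noncomputable def F (n : ℕ) : Polynomial ℚ :=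
  ∑ π : hyperoctahedral n, Polynomial.X ^ fdes π.1

/-- The flag ascent-plateau polynomial `T_n(x) = ∑_{σ ∈ Q_n} x^{fap(σ)}`. -/
noncomputable def T (n : ℕ) : Polynomial ℚ :=
  ∑ σ ∈ stirlingPerms n, Polynomial.X ^ fap σ

/-- The ascent-plateau polynomial `M_n(x) = ∑_{σ ∈ Q_n} x^{ap(σ)}`. -/
noncomputable def M (n : ℕ) : Polynomial ℚ :=
  ∑ σ ∈ stirlingPerms n, Polynomial.X ^ ap σ

end FlagAscentPlateau

/-!
All three families of objects are built by inserting the largest letter: a Stirling permutation of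
order `n + 1` is obtained from a unique one of order `n` by inserting `(n + 1) (n + 1)` into one of
the `2 n + 1` gaps (`sum_stirlingPerms_succ`), and an element of `B_{n+1}` from a unique element of
`B_n` by inserting `±(n + 1)` into one of the `n + 1` gaps of its word (`sum_signedWords_succ`).

If the statistic is `a` before the insertion, the number of insertions that raise it by `0`, `1`
and `2` is

* `a`, `1`, `2 n - a` for `fap`,
* `a + 1`, `0`, `2 n - a` for `2 ap`,
* `a + 1`, `1`, `2 n - a` for `fdes`

(`sum_fap_succ`, `sum_ap_succ`, `sum_fdesWord_succ`). The first line is the action of the grammar on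
`x y^a z^(2 n - a)`, which gives the formula for `D^n(x)`.

With the operator `L_n f = 2 n x² f + (x - x³) f'`, which sends `x^a` to
`a x^a + (2 n - a) x^(a + 2)`, the three lines say
`T_{n+1} = x T_n + L_n T_n`, `M_{n+1}(x²) = M_n(x²) + L_n M_n(x²)` and
`F_{n+1} = (1 + x) F_n + L_n F_n`. Since `L_{k+m}(f g) = (L_k f) g + f (L_m g)`, the binomial
convolution of `T` and `M(x²)` satisfies the recurrence of `F`, and the two agree
(`F_eq_sum_choose`).
-/

namespace FlagAscentPlateau
open Polynomial List

/-! ### Inserting a block into a word -/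

/-- The word `w` with the block `s` inserted after its first `j` letters. -/
def insertBlock {α : Type*} (s w : List α) (j : ℕ) : List α := w.take j ++ s ++ w.drop j

@[simp] theorem insertBlock_zero {α : Type*} (s w : List α) : insertBlock s w 0 = s ++ w := by
  simp [insertBlock]

@[simp] theorem insertBlock_nil {α : Type*} (s : List α) (j : ℕ) : insertBlock s [] j = s := by
  simp [insertBlock]

@[simp] theorem insertBlock_cons_succ {α : Type*} (s w : List α) (b : α) (j : ℕ) :
    insertBlock s (b :: w) (j + 1) = b :: insertBlock s w j := by
  simp [insertBlock]

theorem insertBlock_append_length {α : Type*} (s u v : List α) :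
    insertBlock s (u ++ v) u.length = u ++ s ++ v := by
  simp [insertBlock]

theorem insertBlock_perm {α : Type*} (s w : List α) (j : ℕ) : insertBlock s w j ~ s ++ w := by
  conv_rhs => rw [← List.take_append_drop j w, ← List.append_assoc]
  exact List.perm_append_comm.append_right _

/-- A word is cut in only one way at its first letter satisfying `P`. -/
theorem append_cons_inj_of_forall {α : Type*} {P : α → Prop} {c c' : α} {u u' v v' : List α}
    (hu : ∀ x ∈ u, ¬ P x) (hu' : ∀ x ∈ u', ¬ P x) (hc : P c) (hc' : P c')
    (h : u ++ c :: v = u' ++ c' :: v') : u = u' ∧ c = c' ∧ v = v' := by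
  induction u generalizing u' with
  | nil =>
    cases u' with
    | nil => simpa using h
    | cons b u' =>
      simp only [List.nil_append, List.cons_append, List.cons.injEq] at h
      exact absurd (h.1 ▸ hc) (hu' b (by simp))
  | cons a u ih =>
    cases u' with
    | nil =>
      simp only [List.nil_append, List.cons_append, List.cons.injEq] at h
      exact absurd (h.1 ▸ hc') (hu a (by simp))
    | cons b u' =>
      simp only [List.cons_append, List.cons.injEq] at h
      obtain ⟨h1, h2, h3⟩ := ih (fun x hx => hu x (by simp [hx]))
        (fun x hx => hu' x (by simp [hx])) h.2
      exact ⟨by rw [h.1, h1], h2, h3⟩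

/-- The word, the position and the first inserted letter are determined by the result of the
insertion, as long as that letter can be told apart (by `P`) from the letters of the word. -/
theorem insertBlock_inj_of_forall {α : Type*} {P : α → Prop} {c c' : α} {s s' w w' : List α}
    {j j' : ℕ} (hw : ∀ x ∈ w, ¬ P x) (hw' : ∀ x ∈ w', ¬ P x) (hc : P c) (hc' : P c')
    (hs : s.length = s'.length) (hj : j ≤ w.length) (hj' : j' ≤ w'.length)
    (h : insertBlock (c :: s) w j = insertBlock (c' :: s') w' j') : c = c' ∧ w = w' ∧ j = j' := by
  simp only [insertBlock, List.append_assoc, List.cons_append] at h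
  obtain ⟨h1, h2, h3⟩ := append_cons_inj_of_forall
    (fun x hx => hw x (List.mem_of_mem_take hx)) (fun x hx => hw' x (List.mem_of_mem_take hx))
    hc hc' h
  have h4 := List.append_inj_right h3 hs
  refine ⟨h2, ?_, ?_⟩
  · rw [← List.take_append_drop j w, h1, h4, List.take_append_drop]
  · have := congrArg List.length h1
    simpa [hj, hj'] using this

/-! ### Ascent-plateaus computed letter by letter -/

/-- The number of ascent-plateaus of the word `p :: w`; the letter `p` in front is kept as a
separate argument so that the count can be computed by recursion on `w`. -/
def apFrom : ℕ → List ℕ → ℕ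
  | _, [] => 0
  | p, b :: w => (if p < b ∧ w.head? = some b then 1 else 0) + apFrom b w

theorem ap_nil : ap [] = 0 := by simp [ap]

theorem ap_cons (a : ℕ) (w : List ℕ) : ap (a :: w) = apFrom a w := by
  induction w generalizing a with
  | nil => simp [ap, apFrom]
  | cons b w ih =>
    rw [apFrom, ← ih]
    cases w with
    | nil => simp [ap]
    | cons c w =>
      simp only [ap, Finset.card_filter, List.length_cons, List.head?_cons, Option.some.injEq]
      rw [show w.length + 1 + 1 + 1 - 2 = w.length + 1 by omega,
        show w.length + 1 + 1 - 2 = w.length by omega, Finset.sum_range_succ']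
      simp only [List.getD_cons_succ, List.getD_cons_zero]
      rw [add_comm]
      simp only [eq_comm]

theorem fap_nil : fap [] = 0 := by simp [fap, ap]

theorem fap_cons (b : ℕ) (w : List ℕ) :
    fap (b :: w) = 2 * apFrom b w + if w.head? = some b then 1 else 0 := by
  rw [fap, ap_cons]
  cases w with
  | nil => simp
  | cons c w =>
    simp only [List.length_cons, List.getD_cons_succ, List.getD_cons_zero, List.head?_cons,
      Option.some.injEq, eq_comm (a := b)]
    split_ifs <;> grind

/-- Ascent-plateaus occupy disjoint pairs of letters of `w`. -/
theorem two_mul_apFrom_le (p : ℕ) (w : List ℕ) : 2 * apFrom p w ≤ w.length := by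
  induction hn : w.length using Nat.strong_induction_on generalizing p w with
  | _ n ih =>
  match w with
  | [] => simp [apFrom]
  | [b] => simp [apFrom]
  | b :: c :: w =>
    have h1 := ih (w.length + 1) (by simp at hn; omega) b (c :: w) (by simp)
    have h2 := ih w.length (by simp at hn; omega) c w rfl
    simp only [apFrom, List.length_cons, List.head?_cons, Option.some.injEq] at h1 hn ⊢
    split_ifs at h1 ⊢ <;> omega

theorem fap_le_length (σ : List ℕ) : fap σ ≤ σ.length := by
  cases σ with
  | nil => simp [fap_nil]
  | cons b w =>
    rw [fap_cons]
    have h := two_mul_apFrom_le b w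
    cases w with
    | nil => simp [apFrom]
    | cons c w =>
      have h2 := two_mul_apFrom_le c w
      simp only [apFrom, List.length_cons, List.head?_cons, Option.some.injEq] at h ⊢
      split_ifs at h ⊢ <;> omega

/-! ### How the statistics change under insertion -/

section Insertion
variable {R : Type*} [CommRing R]

/-- Insertion of `m m`, with `m` larger than all letters, into the `|w| + 1` gaps of `w` (the gap
after the leading letter `p` included). In the two inner gaps of an ascent-plateau `a b b` this
destroys the ascent-plateau and creates a new one, so that the number is unchanged; in every other
gap it raises the number by one. No two ascent-plateaus share a gap. -/
theorem sum_apFrom_insertBlock {m : ℕ} (g : ℕ → R) (p : ℕ) (w : List ℕ) (hp : p < m)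
    (hw : ∀ x ∈ w, x < m) :
    ∑ j ∈ Finset.range (w.length + 1), g (apFrom p (insertBlock [m, m] w j)) =
      2 * (apFrom p w : R) * g (apFrom p w) +
        ((w.length : R) + 1 - 2 * (apFrom p w : R)) * g (apFrom p w + 1) := by
  induction hn : w.length using Nat.strong_induction_on generalizing p w g with
  | _ n ih =>
  match w with
  | [] => subst hn; simp [apFrom, hp]
  | [b] =>
    subst hn
    have hb : b < m := hw b (by simp)
    simp [apFrom, hp, hb, hb.not_gt, Finset.sum_range_succ, hb.ne']
    ring
  | b :: c :: w =>
    subst hn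
    have hb : b < m := hw b (by simp)
    have hc : c < m := hw c (by simp)
    have ih1 := ih _ (by simp) g b (c :: w) hb (fun x hx => hw x (by grind)) rfl
    have ih2 := ih w.length (by simp) (fun i => g (i + 1)) c w hc
      (fun x hx => hw x (by grind)) rfl
    rw [List.length_cons, Finset.sum_range_succ', List.length_cons, Finset.sum_range_succ']
    rw [List.length_cons, Finset.sum_range_succ'] at ih1
    -- If `p b c` is an ascent-plateau, its two gaps are split off and the recursion starts
    -- after `c`.
    by_cases h : p < b ∧ c = b
    · obtain ⟨h1, rfl⟩ := h
      simp [apFrom, hp, hb, hb.not_gt, h1, hb.ne', hb.ne, add_comm 1] at ih1 ih2 ⊢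
      rw [ih2]
      ring
    · simp [apFrom, hp, hb, hb.not_gt, hc.not_gt, h, hb.ne', hb.ne, add_comm 1] at ih1 ih2 ⊢
      rw [ih1]
      ring

/-- At the front of the word the block `m m` creates no ascent-plateau, which explains the
additional `+ 1` compared with `sum_apFrom_insertBlock`. -/
theorem sum_ap_insertBlock {m : ℕ} (g : ℕ → R) (w : List ℕ) (hw : ∀ x ∈ w, x < m) :
    ∑ j ∈ Finset.range (w.length + 1), g (ap (insertBlock [m, m] w j)) =
      (2 * (ap w : R) + 1) * g (ap w) + ((w.length : R) - 2 * (ap w : R)) * g (ap w + 1) := by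
  cases w with
  | nil => simp [ap]
  | cons b w =>
    have hb : b < m := hw b (by simp)
    have h := sum_apFrom_insertBlock g b w hb (fun x hx => hw x (by simp [hx]))
    rw [List.length_cons, Finset.sum_range_succ']
    simp only [insertBlock_cons_succ, insertBlock_zero, ap_cons, h, List.cons_append,
      List.nil_append]
    simp [apFrom, hb.not_gt]
    ring

/-- Insertion of `m m` into a word with `fap` equal to `a` leaves `fap` unchanged in `a` gaps, raises
it by `1` in one gap and by `2` in the remaining ones. If the first two letters differ, the gap with
the increment `1` is the front; if they are equal, it is the gap between them, and the front leaves
`fap` unchanged. -/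
theorem sum_fap_insertBlock {m : ℕ} (g : ℕ → R) (w : List ℕ) (hw : ∀ x ∈ w, x < m) :
    ∑ j ∈ Finset.range (w.length + 1), g (fap (insertBlock [m, m] w j)) =
      (fap w : R) * g (fap w) + g (fap w + 1) +
        ((w.length : R) - (fap w : R)) * g (fap w + 2) := by
  match w with
  | [] => simp [fap_nil, fap_cons, apFrom]
  | [b] =>
    have hb : b < m := hw b (by simp)
    simp [fap_cons, apFrom, Finset.sum_range_succ, hb, hb.not_gt, hb.ne']
  | b :: c :: w =>
    have hb : b < m := hw b (by simp)
    have hc : c < m := hw c (by simp)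
    have ih1 := sum_apFrom_insertBlock (fun i => g (2 * i)) b (c :: w) hb
      (fun x hx => hw x (by grind))
    have ih2 := sum_apFrom_insertBlock (fun i => g (2 * i + 1)) c w hc
      (fun x hx => hw x (by grind))
    rw [List.length_cons, Finset.sum_range_succ', List.length_cons, Finset.sum_range_succ']
    rw [List.length_cons, Finset.sum_range_succ'] at ih1
    -- If `b = c`, the two gaps before `c` are split off and the recursion starts after `c`.
    by_cases h : c = b
    · subst h
      simp [fap_cons, apFrom, hb, hb.not_gt, hb.ne', hb.ne, add_comm 1, mul_add] at ih1 ih2 ⊢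
      rw [ih2]
      ring_nf
    · simp [fap_cons, apFrom, hb, hb.not_gt, hc.not_gt, h, hb.ne', hb.ne, add_comm 1, mul_add]
        at ih1 ih2 ⊢
      rw [ih1]
      ring

/-- The number of descents of the word `p :: w`. -/
def desFrom : ℤ → List ℤ → ℕ
  | _, [] => 0
  | p, b :: w => (if b < p then 1 else 0) + desFrom b w

/-- The flag descent number of a word of integers. -/
def fdesWord : List ℤ → ℕ
  | [] => 0
  | b :: w => 2 * desFrom b w + if b < 0 then 1 else 0

/-- A letter larger than all others keeps the number of descents when it splits a descent or is put
at the end. -/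
theorem sum_desFrom_insertBlock_of_gt {m : ℤ} (g : ℕ → R) (p : ℤ) (w : List ℤ) (hp : p < m)
    (hw : ∀ x ∈ w, x < m) :
    ∑ j ∈ Finset.range (w.length + 1), g (desFrom p (insertBlock [m] w j)) =
      ((desFrom p w : R) + 1) * g (desFrom p w) +
        ((w.length : R) - (desFrom p w : R)) * g (desFrom p w + 1) := by
  induction w generalizing p g with
  | nil => simp [desFrom, hp.not_gt]
  | cons b w ih =>
    have hb : b < m := hw b (by simp)
    have hw' : ∀ x ∈ w, x < m := fun x hx => hw x (by simp [hx])
    rw [List.length_cons, Finset.sum_range_succ']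
    by_cases h : b < p
    · have := ih (fun i => g (i + 1)) b hb hw'
      simp [desFrom, h, hb, hp.not_gt, add_comm 1] at this ⊢
      rw [this]
      ring
    · have := ih g b hb hw'
      simp [desFrom, h, hb, hp.not_gt, add_comm 1] at this ⊢
      rw [this]
      ring

/-- A letter smaller than all others keeps the number of descents exactly when it splits a
descent. -/
theorem sum_desFrom_insertBlock_of_lt {m : ℤ} (g : ℕ → R) (p : ℤ) (w : List ℤ) (hp : m < p)
    (hw : ∀ x ∈ w, m < x) :
    ∑ j ∈ Finset.range (w.length + 1), g (desFrom p (insertBlock [m] w j)) =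
      (desFrom p w : R) * g (desFrom p w) +
        ((w.length : R) + 1 - (desFrom p w : R)) * g (desFrom p w + 1) := by
  induction w generalizing p g with
  | nil => simp [desFrom, hp]
  | cons b w ih =>
    have hb : m < b := hw b (by simp)
    have hw' : ∀ x ∈ w, m < x := fun x hx => hw x (by simp [hx])
    rw [List.length_cons, Finset.sum_range_succ']
    by_cases h : b < p
    · have := ih (fun i => g (i + 1)) b hb hw'
      simp [desFrom, h, hb.not_gt, hp, add_comm 1] at this ⊢
      rw [this]
      ring
    · have := ih g b hb hw'
      simp [desFrom, h, hb.not_gt, hp, add_comm 1] at this ⊢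
      rw [this]
      ring

/-- Among the insertions of `m` or `-m` into a word with flag descent number `a`, there are `a + 1`
that keep it, one that raises it by `1` and `2 |w| - a` that raise it by `2`. The increment `1` comes
from the front of the word: from `m` if the first letter is negative, from `-m` otherwise. -/
theorem sum_fdesWord_insertBlock {m : ℤ} (hm : 0 < m) (g : ℕ → R) (w : List ℤ)
    (hw : ∀ x ∈ w, |x| < m) :
    ∑ j ∈ Finset.range (w.length + 1),
        (g (fdesWord (insertBlock [m] w j)) + g (fdesWord (insertBlock [-m] w j))) =
      ((fdesWord w : R) + 1) * g (fdesWord w) + g (fdesWord w + 1) +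
        (2 * (w.length : R) - (fdesWord w : R)) * g (fdesWord w + 2) := by
  cases w with
  | nil => simp [fdesWord, desFrom, hm.not_gt, hm]
  | cons b w =>
    have hb := abs_lt.1 (hw b (by simp))
    have hw1 : ∀ x ∈ w, x < m := fun x hx => (abs_lt.1 (hw x (by simp [hx]))).2
    have hw2 : ∀ x ∈ w, -m < x := fun x hx => (abs_lt.1 (hw x (by simp [hx]))).1
    rw [List.length_cons, Finset.sum_range_succ', Finset.sum_add_distrib]
    by_cases h : b < 0
    · have h1 := sum_desFrom_insertBlock_of_gt (fun i => g (2 * i + 1)) b w hb.2 hw1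
      have h2 := sum_desFrom_insertBlock_of_lt (fun i => g (2 * i + 1)) b w hb.1 hw2
      simp [fdesWord, desFrom, h, hm.not_gt, hm, hb.2, hb.1.not_gt] at h1 h2 ⊢
      rw [h1, h2]
      ring_nf
    · have h1 := sum_desFrom_insertBlock_of_gt (fun i => g (2 * i)) b w hb.2 hw1
      have h2 := sum_desFrom_insertBlock_of_lt (fun i => g (2 * i)) b w hb.1 hw2
      simp [fdesWord, desFrom, h, hm.not_gt, hm, hb.2, hb.1.not_gt] at h1 h2 ⊢
      rw [h1, h2]
      ring_nf

end Insertion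

/-! ### Stirling permutations by inserting the largest letter twice -/

/-- The Stirling condition as the avoidance of subwords `a b a` with `b ≤ a`; in this form it is
visibly inherited by subwords. -/
theorem isStirling_iff_sublist {σ : List ℕ} :
    IsStirling σ ↔ ∀ a b, [a, b, a] <+ σ → a < b := by
  constructor
  · intro h a b hs
    obtain ⟨f, hf⟩ := List.sublist_iff_exists_fin_orderEmbedding_get_eq.1 hs
    have h01 : f 0 < f 1 := f.strictMono (by simp)
    have h12 : f 1 < f 2 := f.strictMono (by simp [Fin.lt_def])
    have h0 := hf 0
    have h1 := hf 1
    have h2 := hf 2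
    have := h (f 2) (f 2).2 (f 1) h12 (f 0) h01
    simp at h0 h1 h2
    simp [← h0, ← h1, ← h2] at this
    exact this
  · intro h k hk j hj i hi he
    have hs := List.map_getElem_sublist (l := σ)
      (is := [⟨i, by omega⟩, ⟨j, by omega⟩, ⟨k, hk⟩]) (by simp [hi, hj]; omega)
    rw [List.getD_eq_getElem _ _ hk, List.getD_eq_getElem _ _ (by omega)] at he
    rw [List.getD_eq_getElem _ _ (by omega), List.getD_eq_getElem _ _ (by omega)]
    refine h _ _ ?_
    simpa [← he] using hs

theorem mem_stirlingPerms {n : ℕ} {σ : List ℕ} :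
    σ ∈ stirlingPerms n ↔ σ ~ List.range' 1 n ++ List.range' 1 n ∧ IsStirling σ := by
  have h : (Finset.Icc 1 n).val = (List.range' 1 n : Multiset ℕ) := rfl
  simp only [stirlingPerms, Finset.mem_filter, Multiset.mem_toFinset, Multiset.mem_lists_iff, h,
    Multiset.coe_add, Multiset.quot_mk_to_coe, Multiset.coe_eq_coe]
  rw [List.perm_comm]

theorem length_of_mem_stirlingPerms {n : ℕ} {σ : List ℕ} (h : σ ∈ stirlingPerms n) :
    σ.length = 2 * n := by
  have := (mem_stirlingPerms.1 h).1.length_eq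
  simp at this
  omega

theorem lt_of_mem_stirlingPerms {n : ℕ} {σ : List ℕ} (h : σ ∈ stirlingPerms n) :
    ∀ x ∈ σ, x < n + 1 := by
  intro x hx
  have := (mem_stirlingPerms.1 h).1.subset hx
  simp at this
  omega

theorem range'_append_self_succ_perm (n : ℕ) :
    List.range' 1 (n + 1) ++ List.range' 1 (n + 1) ~
      (n + 1) :: (n + 1) :: (List.range' 1 n ++ List.range' 1 n) := by
  rw [List.range'_1_concat, add_comm 1 n]
  refine List.perm_iff_count.2 fun a => ?_
  simp only [List.count_append, List.count_cons, List.count_nil]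
  omega

theorem isStirling_append_pair {m : ℕ} {u v : List ℕ} (hu : ∀ x ∈ u, x < m) (hv : ∀ x ∈ v, x < m) :
    IsStirling (u ++ m :: m :: v) ↔ IsStirling (u ++ v) := by
  simp only [isStirling_iff_sublist]
  constructor
  · refine fun h a b hs => h a b (hs.trans ?_)
    exact List.Sublist.append_left ((List.sublist_cons_self _ _).trans (List.sublist_cons_self _ _)) u
  · intro h a b hs
    have hmu : m ∉ u := fun hm => lt_irrefl _ (hu m hm)
    have hmv : m ∉ v := fun hm => lt_irrefl _ (hv m hm)
    have hle : ∀ x ∈ u ++ m :: m :: v, x ≤ m := by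
      intro x hx
      simp only [List.mem_append, List.mem_cons] at hx
      rcases hx with hx | rfl | rfl | hx
      · exact (hu x hx).le
      · exact le_rfl
      · exact le_rfl
      · exact (hv x hx).le
    -- A subword `m b m` would need `b` between the two adjacent copies of `m`.
    by_cases ha : a = m
    · subst ha
      exfalso
      obtain ⟨l₁, l₂, hl, h1, h2⟩ := List.sublist_append_iff.1 hs
      cases l₁ with
      | cons c l₁ =>
        simp only [List.cons_append, List.cons.injEq] at hl
        exact hmu (h1.subset (by simp [hl.1]))
      | nil =>
        simp only [List.nil_append] at hl
        subst hl
        have h3 : [b, a] <+ a :: v := List.cons_sublist_cons.1 h2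
        by_cases hb : b = a
        · subst hb
          exact hmv ((List.cons_sublist_cons.1 h3).subset (by simp))
        · have h4 : [b, a] <+ v := by
            cases h3 with
            | cons _ h => exact h
            | cons_cons _ h => exact absurd rfl hb
          exact hmv (h4.subset (by simp))
    · have ham : a < m := lt_of_le_of_ne (hle a (hs.subset (by simp))) ha
      by_cases hb : b = m
      · rwa [hb]
      · -- If `m` does not occur in the subword, it can be removed from the whole word.
        refine h a b ?_
        have h1 := hs.filter (fun x => decide (x ≠ m))
        have hfu : u.filter (fun x => decide (x ≠ m)) = u :=
          List.filter_eq_self.2 fun x hx => by simpa using (hu x hx).ne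
        have hfv : v.filter (fun x => decide (x ≠ m)) = v :=
          List.filter_eq_self.2 fun x hx => by simpa using (hv x hx).ne
        rw [List.filter_append, hfu] at h1
        simp only [ne_eq, List.filter_cons, ha, hb, not_false_eq_true, decide_true, not_true_eq_false,
          decide_false, if_true, Bool.false_eq_true, if_false, List.filter_nil] at h1 hfv
        rwa [hfv] at h1

theorem insertBlock_mem_stirlingPerms {n : ℕ} {σ : List ℕ} (h : σ ∈ stirlingPerms n) (j : ℕ) :
    insertBlock [n + 1, n + 1] σ j ∈ stirlingPerms (n + 1) := by
  have hlt := lt_of_mem_stirlingPerms h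
  obtain ⟨hp, hs⟩ := mem_stirlingPerms.1 h
  refine mem_stirlingPerms.2 ⟨?_, ?_⟩
  · refine List.Perm.trans ?_ (range'_append_self_succ_perm n).symm
    exact (insertBlock_perm _ σ j).trans ((hp.cons _).cons _)
  · rw [insertBlock, List.append_assoc]
    refine (isStirling_append_pair (fun x hx => hlt x (List.mem_of_mem_take hx))
      (fun x hx => hlt x (List.mem_of_mem_drop hx))).2 ?_
    rwa [List.take_append_drop]

/-- The two copies of the largest letter of a Stirling permutation are adjacent, as no letter may
stand between them; removing them gives a Stirling permutation of smaller order. -/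
theorem exists_insertBlock_of_mem_stirlingPerms_succ {n : ℕ} {τ : List ℕ}
    (h : τ ∈ stirlingPerms (n + 1)) :
    ∃ σ ∈ stirlingPerms n, ∃ j ≤ σ.length, insertBlock [n + 1, n + 1] σ j = τ := by
  obtain ⟨hp, hs⟩ := mem_stirlingPerms.1 h
  have hp' := hp.trans (range'_append_self_succ_perm n)
  have hle := lt_of_mem_stirlingPerms h
  obtain ⟨u, v', rfl, hu⟩ := List.eq_append_cons_of_mem (hp'.symm.subset (List.mem_cons_self))
  have hp2 : u ++ v' ~ (n + 1) :: (List.range' 1 n ++ List.range' 1 n) :=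
    (List.perm_middle.symm.trans hp').cons_inv
  have hm : n + 1 ∈ v' := by
    have := hp2.symm.subset (List.mem_cons_self)
    simpa [hu] using this
  obtain ⟨v, rfl⟩ : ∃ v, v' = (n + 1) :: v := by
    cases v' with
    | nil => simp at hm
    | cons c v =>
      by_cases hc : c = n + 1
      · exact ⟨v, by rw [hc]⟩
      · exfalso
        have hv : n + 1 ∈ v := by
          rcases List.mem_cons.1 hm with h1 | h1
          · exact absurd h1.symm hc
          · exact h1
        have h1 : [n + 1, c, n + 1] <+ u ++ (n + 1) :: c :: v :=
          (((List.singleton_sublist.2 hv).cons_cons c).cons_cons (n + 1)).trans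
            (List.sublist_append_right _ _)
        have h2 := isStirling_iff_sublist.1 hs _ _ h1
        have h3 := hle c (by simp)
        omega
  have hp3 : u ++ v ~ List.range' 1 n ++ List.range' 1 n :=
    (List.perm_middle.symm.trans hp2).cons_inv
  have hlt : ∀ x ∈ u ++ v, x < n + 1 := by
    intro x hx
    have := hp3.subset hx
    simp at this
    omega
  refine ⟨u ++ v, mem_stirlingPerms.2 ⟨hp3, ?_⟩, u.length, by simp, by
    rw [insertBlock_append_length]; simp⟩
  exact (isStirling_append_pair (fun x hx => hlt x (by simp [hx]))
    (fun x hx => hlt x (by simp [hx]))).1 hs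

/-- Every Stirling permutation of order `n + 1` arises from exactly one of order `n`, by inserting
`(n + 1) (n + 1)` into one of its gaps. -/
theorem sum_stirlingPerms_succ {R : Type*} [AddCommMonoid R] (f : List ℕ → R) (n : ℕ) :
    ∑ τ ∈ stirlingPerms (n + 1), f τ =
      ∑ σ ∈ stirlingPerms n, ∑ j ∈ Finset.range (σ.length + 1),
        f (insertBlock [n + 1, n + 1] σ j) := by
  rw [Finset.sum_sigma']
  symm
  refine Finset.sum_bij (fun p _ => insertBlock [n + 1, n + 1] p.1 p.2) ?_ ?_ ?_ ?_
  · rintro ⟨σ, j⟩ h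
    simp only [Finset.mem_sigma] at h
    exact insertBlock_mem_stirlingPerms h.1 j
  · rintro ⟨σ, j⟩ h ⟨σ', j'⟩ h' he
    simp only [Finset.mem_sigma, Finset.mem_range] at h h'
    have h1 := lt_of_mem_stirlingPerms h.1
    have h2 := lt_of_mem_stirlingPerms h'.1
    obtain ⟨-, rfl, rfl⟩ := insertBlock_inj_of_forall (P := fun x => x = n + 1)
      (fun x hx => (h1 x hx).ne) (fun x hx => (h2 x hx).ne) rfl rfl rfl
      (Nat.lt_succ_iff.1 h.2) (Nat.lt_succ_iff.1 h'.2) he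
    rfl
  · intro τ h
    obtain ⟨σ, hσ, j, hj, he⟩ := exists_insertBlock_of_mem_stirlingPerms_succ h
    exact ⟨⟨σ, j⟩, by simp [hσ]; omega, he⟩
  · intros
    rfl

theorem stirlingPerms_zero : stirlingPerms 0 = {[]} := by
  ext σ
  simp only [mem_stirlingPerms, Finset.mem_singleton]
  constructor
  · rintro ⟨h, -⟩
    simpa using h
  · rintro rfl
    simp [IsStirling]

theorem sum_fap_succ {R : Type*} [CommRing R] (g : ℕ → R) (n : ℕ) :
    ∑ τ ∈ stirlingPerms (n + 1), g (fap τ) =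
      ∑ σ ∈ stirlingPerms n, ((fap σ : R) * g (fap σ) + g (fap σ + 1) +
        (2 * (n : R) - (fap σ : R)) * g (fap σ + 2)) := by
  rw [sum_stirlingPerms_succ]
  refine Finset.sum_congr rfl fun σ hσ => ?_
  rw [sum_fap_insertBlock g σ (lt_of_mem_stirlingPerms hσ), length_of_mem_stirlingPerms hσ]
  push_cast
  rfl

theorem sum_ap_succ {R : Type*} [CommRing R] (g : ℕ → R) (n : ℕ) :
    ∑ τ ∈ stirlingPerms (n + 1), g (ap τ) =
      ∑ σ ∈ stirlingPerms n, ((2 * (ap σ : R) + 1) * g (ap σ) +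
        (2 * (n : R) - 2 * (ap σ : R)) * g (ap σ + 1)) := by
  rw [sum_stirlingPerms_succ]
  refine Finset.sum_congr rfl fun σ hσ => ?_
  rw [sum_ap_insertBlock g σ (lt_of_mem_stirlingPerms hσ), length_of_mem_stirlingPerms hσ]
  push_cast
  rfl

/-! ### The words of signed permutations -/

/-- The word `π(1) π(2) ⋯ π(n)` of a permutation of `±[n]`. -/
noncomputable def word {n : ℕ} (π : Equiv.Perm (PM n)) : List ℤ := (List.range' 1 n).map (entry π)

theorem desFrom_map_range' (f : ℕ → ℤ) (s k : ℕ) :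
    desFrom (f s) ((List.range' (s + 1) k).map f) =
      ((Finset.Ico s (s + k)).filter fun i => f i > f (i + 1)).card := by
  induction k generalizing s with
  | zero => simp [desFrom]
  | succ k ih =>
    rw [List.range'_succ, List.map_cons, desFrom, ih, Finset.card_filter, Finset.card_filter,
      Finset.sum_eq_sum_Ico_succ_bot (a := s) (by omega)]
    congr 3
    omega

theorem fdes_eq_fdesWord {n : ℕ} (π : Equiv.Perm (PM n)) : fdes π = fdesWord (word π) := by
  cases n with
  | zero => simp [fdes, desA, word, fdesWord, entry]
  | succ k =>
    rw [word, List.range'_succ, List.map_cons, fdesWord, desFrom_map_range', fdes, desA,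
      add_comm 1 k]
    split_ifs <;> rfl

theorem PM.val_bounds {n : ℕ} (k : PM n) : k.1 ≠ 0 ∧ -(n : ℤ) ≤ k.1 ∧ k.1 ≤ n := by
  have h := k.2
  simpa only [Finset.mem_erase, Finset.mem_Icc, ne_eq] using h

theorem PM.val_neg {n : ℕ} (k : PM n) : (-k).1 = -k.1 := rfl

theorem mem_PM_of_natCast {n i : ℕ} (h1 : 1 ≤ i) (h2 : i ≤ n) :
    (i : ℤ) ∈ (Finset.Icc (-(n : ℤ)) n).erase 0 := by
  simp only [Finset.mem_erase, Finset.mem_Icc, ne_eq]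
  omega

theorem entry_of_mem {n i : ℕ} (π : Equiv.Perm (PM n)) (h1 : 1 ≤ i) (h2 : i ≤ n) :
    entry π i = (π ⟨i, mem_PM_of_natCast h1 h2⟩).1 := by
  rw [entry, dif_pos]

theorem natAbs_word_perm {n : ℕ} {π : Equiv.Perm (PM n)} (hπ : π ∈ hyperoctahedral n) :
    (word π).map Int.natAbs ~ List.range' 1 n := by
  rw [word, List.map_map]
  refine List.Subperm.perm_of_length_le (List.subperm_of_subset ?_ ?_) (by simp)
  · refine List.Nodup.map_on ?_ List.nodup_range'
    intro i hi j hj h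
    rw [List.mem_range'_1] at hi hj
    simp only [Function.comp, entry_of_mem π hi.1 (by omega : i ≤ n),
      entry_of_mem π hj.1 (by omega : j ≤ n)] at h
    rcases Int.natAbs_eq_natAbs_iff.1 h with h | h
    · have := congrArg Subtype.val (π.injective (Subtype.ext h))
      simpa using this
    · rw [← PM.val_neg, ← hπ] at h
      have := congrArg Subtype.val (π.injective (Subtype.ext h))
      rw [PM.val_neg] at this
      simp only at this
      omega
  · intro x hx
    obtain ⟨i, hi, rfl⟩ := List.mem_map.1 hx
    rw [List.mem_range'_1] at hi ⊢
    have := PM.val_bounds (π ⟨i, mem_PM_of_natCast hi.1 (by omega : i ≤ n)⟩)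
    simp only [Function.comp, entry_of_mem π hi.1 (by omega : i ≤ n)]
    omega

theorem word_injOn {n : ℕ} {π ρ : Equiv.Perm (PM n)} (hπ : π ∈ hyperoctahedral n)
    (hρ : ρ ∈ hyperoctahedral n) (h : word π = word ρ) : π = ρ := by
  have hpos : ∀ i (h1 : 1 ≤ i) (h2 : i ≤ n),
      π ⟨(i : ℕ), mem_PM_of_natCast h1 h2⟩ = ρ ⟨(i : ℕ), mem_PM_of_natCast h1 h2⟩ := by
    intro i h1 h2
    apply Subtype.ext
    rw [← entry_of_mem π h1 h2, ← entry_of_mem ρ h1 h2]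
    exact List.map_inj_left.1 h i (by rw [List.mem_range'_1]; omega)
  ext k
  have hk := PM.val_bounds k
  rcases lt_or_gt_of_ne hk.1 with h0 | h0
  · have e : k = -⟨(k.1.natAbs : ℤ), mem_PM_of_natCast (n := n) (by omega) (by omega)⟩ := by
      apply Subtype.ext
      rw [PM.val_neg]
      simp only
      omega
    rw [e, hπ, hρ, hpos _ (by omega) (by omega)]
  · have e : k = ⟨(k.1.natAbs : ℤ), mem_PM_of_natCast (n := n) (by omega) (by omega)⟩ := by
      apply Subtype.ext
      simp only
      omega
    rw [e, hpos _ (by omega) (by omega)]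

/-- Every word whose absolute values form a permutation of `1, …, n` comes from a signed
permutation, namely `k ↦ sign(k) w_{|k|}`. -/
theorem exists_word_eq {n : ℕ} {w : List ℤ} (hw : w.map Int.natAbs ~ List.range' 1 n) :
    ∃ π ∈ hyperoctahedral n, word π = w := by
  have hlen : w.length = n := by simpa using hw.length_eq
  have hnd : (w.map Int.natAbs).Nodup := hw.nodup_iff.2 List.nodup_range'
  have hb : ∀ i (hi : i < w.length), 1 ≤ (w[i]).natAbs ∧ (w[i]).natAbs ≤ n := by
    intro i hi
    have := hw.subset (List.mem_map_of_mem (List.getElem_mem hi))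
    rw [List.mem_range'_1] at this
    omega
  have hlt : ∀ k : PM n, k.1.natAbs - 1 < w.length := fun k => by
    have := PM.val_bounds k
    omega
  have habs : ∀ k : PM n, (k.1.sign * w[k.1.natAbs - 1]'(hlt k)).natAbs =
      (w[k.1.natAbs - 1]'(hlt k)).natAbs := fun k => by
    rw [Int.natAbs_mul, Int.natAbs_sign_of_ne_zero (PM.val_bounds k).1, one_mul]
  let f : PM n → PM n := fun k => ⟨k.1.sign * w[k.1.natAbs - 1]'(hlt k), by
    have h1 := habs k
    have h2 := hb _ (hlt k)
    simp only [Finset.mem_erase, Finset.mem_Icc, ne_eq]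
    generalize k.1.sign * w[k.1.natAbs - 1]'(hlt k) = z at *
    omega⟩
  have hf : Function.Injective f := by
    intro k l h
    have h1 : k.1.sign * w[k.1.natAbs - 1]'(hlt k) = l.1.sign * w[l.1.natAbs - 1]'(hlt l) :=
      congrArg Subtype.val h
    have h2 := congrArg Int.natAbs h1
    rw [habs, habs] at h2
    have h3 : k.1.natAbs - 1 = l.1.natAbs - 1 := by
      refine (hnd.getElem_inj_iff (hi := by simpa using hlt k) (hj := by simpa using hlt l)).1 ?_
      simpa using h2
    have hk := PM.val_bounds k
    have hl := PM.val_bounds l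
    simp only [h3] at h1
    have h4 : w[l.1.natAbs - 1]'(hlt l) ≠ 0 := by
      have := hb _ (hlt l)
      intro h0
      rw [h0] at this
      simp at this
    have h5 := mul_right_cancel₀ h4 h1
    apply Subtype.ext
    rw [← Int.sign_mul_natAbs k.1, ← Int.sign_mul_natAbs l.1, h5]
    congr 2
    omega
  refine ⟨Equiv.ofBijective f (Finite.injective_iff_bijective.1 hf), ?_, ?_⟩
  · intro k
    apply Subtype.ext
    simp [f, PM.val_neg]
  · refine List.ext_getElem (by simp [word, hlen]) ?_
    intro i h1 h2
    have h3 : 1 + i ≤ n := by omega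
    simp only [word, List.getElem_map, List.getElem_range', one_mul]
    rw [entry_of_mem _ (by omega) h3]
    have h4 : (((1 + i : ℕ) : ℤ)).sign = 1 := Int.sign_eq_one_of_pos (by omega)
    simp only [Equiv.ofBijective_apply, f, h4, one_mul]
    congr 1
    omega

/-! ### Signed permutations by inserting the largest letter -/

/-- The set of words of the elements of `B_n`. -/
noncomputable def signedWords (n : ℕ) : Finset (List ℤ) :=
  Finset.univ.image fun π : hyperoctahedral n => word π.1

theorem mem_signedWords {n : ℕ} {w : List ℤ} :
    w ∈ signedWords n ↔ w.map Int.natAbs ~ List.range' 1 n := by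
  simp only [signedWords, Finset.mem_image, Finset.mem_univ, true_and]
  constructor
  · rintro ⟨π, rfl⟩
    exact natAbs_word_perm π.2
  · intro h
    obtain ⟨π, hπ, rfl⟩ := exists_word_eq h
    exact ⟨⟨π, hπ⟩, rfl⟩

theorem F_eq_sum_signedWords (n : ℕ) :
    F n = ∑ w ∈ signedWords n, (X : ℚ[X]) ^ fdesWord w := by
  rw [signedWords, Finset.sum_image]
  · simp only [F, fdes_eq_fdesWord]
  · intro π _ ρ _ h
    exact Subtype.ext (word_injOn π.2 ρ.2 h)

theorem length_of_mem_signedWords {n : ℕ} {w : List ℤ} (h : w ∈ signedWords n) :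
    w.length = n := by
  simpa using (mem_signedWords.1 h).length_eq

theorem abs_lt_of_mem_signedWords {n : ℕ} {w : List ℤ} (h : w ∈ signedWords n) :
    ∀ x ∈ w, |x| < (n + 1 : ℤ) := by
  intro x hx
  have := (mem_signedWords.1 h).subset (List.mem_map_of_mem hx)
  rw [List.mem_range'_1] at this
  rw [Int.abs_eq_natAbs]
  omega

theorem signedWords_zero : signedWords 0 = {[]} := by
  ext w
  simp [mem_signedWords]

theorem insertBlock_singleton_mem_signedWords_iff {n j : ℕ} {c : ℤ} {w : List ℤ}
    (hc : c.natAbs = n + 1) :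
    insertBlock [c] w j ∈ signedWords (n + 1) ↔ w ∈ signedWords n := by
  have h1 : insertBlock [c] w j ~ c :: w := insertBlock_perm [c] w j
  rw [mem_signedWords, mem_signedWords, (h1.map _).congr_left, List.map_cons, hc,
    List.range'_1_concat, (List.perm_append_singleton _ _).congr_right, add_comm 1 n,
    List.perm_cons]

/-- Every element of `B_{n+1}` arises from exactly one element of `B_n`, by inserting `n + 1` or
`-(n + 1)` into one of the gaps of its word. -/
theorem sum_signedWords_succ {R : Type*} [AddCommMonoid R] (f : List ℤ → R) (n : ℕ) :
    ∑ τ ∈ signedWords (n + 1), f τ =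
      ∑ w ∈ signedWords n, ∑ j ∈ Finset.range (w.length + 1),
        (f (insertBlock [(n + 1 : ℤ)] w j) + f (insertBlock [-(n + 1 : ℤ)] w j)) := by
  have hne : (n + 1 : ℤ) ≠ -(n + 1 : ℤ) := by omega
  have hc : ∀ c ∈ ({(n + 1 : ℤ), -(n + 1 : ℤ)} : Finset ℤ), c.natAbs = n + 1 := by
    intro c h
    simp only [Finset.mem_insert, Finset.mem_singleton] at h
    omega
  have hlt : ∀ w ∈ signedWords n, ∀ x ∈ w, ¬ x.natAbs = n + 1 := by
    intro w hw x hx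
    have := abs_lt_of_mem_signedWords hw x hx
    rw [Int.abs_eq_natAbs] at this
    omega
  have hpair : ∀ w j, f (insertBlock [(n + 1 : ℤ)] w j) + f (insertBlock [-(n + 1 : ℤ)] w j) =
      ∑ c ∈ {(n + 1 : ℤ), -(n + 1 : ℤ)}, f (insertBlock [c] w j) :=
    fun w j => (Finset.sum_pair (f := fun c => f (insertBlock [c] w j)) hne).symm
  simp only [hpair]
  rw [Finset.sum_sigma', Finset.sum_sigma']
  symm
  refine Finset.sum_bij (fun p _ => insertBlock [p.2] p.1.1 p.1.2) ?_ ?_ ?_ ?_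
  · rintro ⟨⟨w, j⟩, c⟩ h
    simp only [Finset.mem_sigma] at h
    exact (insertBlock_singleton_mem_signedWords_iff (hc c h.2)).2 h.1.1
  · rintro ⟨⟨w, j⟩, c⟩ h ⟨⟨w', j'⟩, c'⟩ h' he
    simp only [Finset.mem_sigma, Finset.mem_range] at h h'
    obtain ⟨rfl, rfl, rfl⟩ := insertBlock_inj_of_forall (P := fun x : ℤ => x.natAbs = n + 1)
      (hlt w h.1.1) (hlt w' h'.1.1) (hc c h.2) (hc c' h'.2) rfl
      (Nat.lt_succ_iff.1 h.1.2) (Nat.lt_succ_iff.1 h'.1.2) he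
    rfl
  · intro τ h
    have hm : n + 1 ∈ τ.map Int.natAbs := by
      refine (mem_signedWords.1 h).symm.subset ?_
      rw [List.mem_range'_1]
      omega
    obtain ⟨c, hcτ, hcn⟩ := List.mem_map.1 hm
    obtain ⟨u, v, rfl⟩ := List.append_of_mem hcτ
    have he : insertBlock [c] (u ++ v) u.length = u ++ c :: v := by
      rw [insertBlock_append_length]; simp
    refine ⟨⟨⟨u ++ v, u.length⟩, c⟩, ?_, he⟩
    rw [← he, insertBlock_singleton_mem_signedWords_iff hcn] at h
    simp only [Finset.mem_sigma, h, Finset.mem_range, List.length_append, Finset.mem_insert,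
      Finset.mem_singleton, true_and]
    omega
  · intros
    rfl

theorem sum_fdesWord_succ {R : Type*} [CommRing R] (g : ℕ → R) (n : ℕ) :
    ∑ τ ∈ signedWords (n + 1), g (fdesWord τ) =
      ∑ w ∈ signedWords n, (((fdesWord w : R) + 1) * g (fdesWord w) + g (fdesWord w + 1) +
        (2 * (n : R) - (fdesWord w : R)) * g (fdesWord w + 2)) := by
  rw [sum_signedWords_succ]
  refine Finset.sum_congr rfl fun w hw => ?_
  rw [sum_fdesWord_insertBlock (by omega) g w (abs_lt_of_mem_signedWords hw),
    length_of_mem_signedWords hw]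

/-! ### The three enumerative polynomials -/

/-- The operator `f ↦ 2 n x² f + (x - x³) f'`. It is the restriction of the formal derivative of the
grammar to homogeneous polynomials of degree `2 n` in `y` and `z`, written in terms of `x` by setting
`y = x` and `z = 1`. -/
noncomputable def flagOp (n : ℕ) (f : ℚ[X]) : ℚ[X] :=
  2 * (n : ℚ[X]) * X ^ 2 * f + (1 - X ^ 2) * (X * derivative f)

theorem flagOp_sum {ι : Type*} (n : ℕ) (s : Finset ι) (f : ι → ℚ[X]) :
    flagOp n (∑ i ∈ s, f i) = ∑ i ∈ s, flagOp n (f i) := by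
  simp only [flagOp, derivative_sum, Finset.mul_sum, Finset.sum_add_distrib]

theorem flagOp_X_pow (n a : ℕ) :
    flagOp n (X ^ a) = (a : ℚ[X]) * X ^ a + (2 * (n : ℚ[X]) - (a : ℚ[X])) * X ^ (a + 2) := by
  cases a with
  | zero => simp [flagOp]
  | succ a =>
    simp only [flagOp, derivative_X_pow, Nat.add_sub_cancel, map_natCast]
    push_cast
    ring

/-- The product rule, in which the degrees of the two homogeneous factors add up. -/
theorem flagOp_natCast_mul_mul {k m n : ℕ} (h : k + m = n) (c : ℕ) (f g : ℚ[X]) :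
    flagOp n ((c : ℚ[X]) * f * g) = c * (flagOp k f * g + f * flagOp m g) := by
  subst h
  simp only [flagOp, derivative_mul, derivative_natCast]
  push_cast
  ring

theorem T_succ (n : ℕ) : T (n + 1) = X * T n + flagOp n (T n) := by
  rw [T, sum_fap_succ, T, flagOp_sum, Finset.mul_sum, ← Finset.sum_add_distrib]
  refine Finset.sum_congr rfl fun σ _ => ?_
  rw [flagOp_X_pow]
  ring

theorem M_comp_sq (n : ℕ) :
    (M n).comp (X ^ 2) = ∑ σ ∈ stirlingPerms n, (X : ℚ[X]) ^ (2 * ap σ) := by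
  simp [M, Polynomial.sum_comp, pow_mul]

theorem M_comp_sq_succ (n : ℕ) :
    (M (n + 1)).comp (X ^ 2) = (M n).comp (X ^ 2) + flagOp n ((M n).comp (X ^ 2)) := by
  rw [M_comp_sq, M_comp_sq, sum_ap_succ (fun i => (X : ℚ[X]) ^ (2 * i)), flagOp_sum,
    ← Finset.sum_add_distrib]
  refine Finset.sum_congr rfl fun σ _ => ?_
  rw [flagOp_X_pow]
  push_cast
  ring

theorem F_succ (n : ℕ) : F (n + 1) = (1 + X) * F n + flagOp n (F n) := by
  rw [F_eq_sum_signedWords, F_eq_sum_signedWords, sum_fdesWord_succ, flagOp_sum, Finset.mul_sum,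
    ← Finset.sum_add_distrib]
  refine Finset.sum_congr rfl fun w _ => ?_
  rw [flagOp_X_pow]
  ring

/-- Both sides satisfy the recurrence of `F_succ`: for the right-hand side this follows from the
product rule, the recurrences of `T` and `M(x²)`, and Pascal's rule. In terms of the grammar it is Leibniz'
formula for the iterated derivatives of the product `x y`. -/
theorem F_eq_sum_choose (n : ℕ) :
    F n = ∑ k ∈ Finset.range (n + 1),
      (n.choose k : ℚ[X]) * T k * (M (n - k)).comp (X ^ 2) := by
  induction n with
  | zero => simp [F_eq_sum_signedWords, signedWords_zero, fdesWord, T, M, stirlingPerms_zero,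
      fap_nil, ap_nil]
  | succ n ih =>
    have h := Finset.sum_choose_succ_mul (fun k m => T k * (M m).comp (X ^ 2)) n
    simp only [← mul_assoc] at h
    rw [h, F_succ, ih, flagOp_sum, Finset.mul_sum, ← Finset.sum_add_distrib,
      ← Finset.sum_add_distrib]
    refine Finset.sum_congr rfl fun k hk => ?_
    have hk' : k ≤ n := Nat.lt_succ_iff.1 (Finset.mem_range.1 hk)
    rw [flagOp_natCast_mul_mul (Nat.add_sub_cancel' hk'), T_succ, Nat.sub_add_comm hk',
      M_comp_sq_succ]
    ring

/-! ### The formal derivative of the grammar -/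

/-- The three coefficients `a`, `1`, `b` match those of `sum_fap_insertBlock`. -/
theorem formalDerivative_monomial (a b : ℕ) :
    formalDerivative flagGrammar (lx * (ly ^ a * lz ^ b)) =
      lx * ((a : MvPowerSeries Letter ℚ) * (ly ^ a * lz ^ (b + 2)) + ly ^ (a + 1) * lz ^ (b + 1) +
        (b : MvPowerSeries Letter ℚ) * (ly ^ (a + 2) * lz ^ b)) := by
  have hx : formalDerivative flagGrammar lx = lx * ly * lz := formalDerivative_X _ _
  have hy : formalDerivative flagGrammar ly = ly * lz ^ 2 := formalDerivative_X _ _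
  have hz : formalDerivative flagGrammar lz = ly ^ 2 * lz := formalDerivative_X _ _
  have hya : formalDerivative flagGrammar (ly ^ a) =
      (a : MvPowerSeries Letter ℚ) * (ly ^ a * lz ^ 2) := by
    rw [Derivation.leibniz_pow, hy]
    cases a with
    | zero => simp
    | succ a => simp only [nsmul_eq_mul, smul_eq_mul, Nat.add_sub_cancel]; ring
  have hzb : formalDerivative flagGrammar (lz ^ b) =
      (b : MvPowerSeries Letter ℚ) * (ly ^ 2 * lz ^ b) := by
    rw [Derivation.leibniz_pow, hz]
    cases b with
    | zero => simp
    | succ b => simp only [nsmul_eq_mul, smul_eq_mul, Nat.add_sub_cancel]; ring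
  rw [Derivation.leibniz, Derivation.leibniz, hx, hya, hzb]
  simp only [smul_eq_mul]
  ring

theorem fap_le_of_mem_stirlingPerms {n : ℕ} {σ : List ℕ} (h : σ ∈ stirlingPerms n) :
    fap σ ≤ 2 * n :=
  (fap_le_length σ).trans_eq (length_of_mem_stirlingPerms h)

theorem iterate_formalDerivative_lx (n : ℕ) :
    (formalDerivative flagGrammar)^[n] lx =
      lx * ∑ σ ∈ stirlingPerms n, ly ^ fap σ * lz ^ (2 * n - fap σ) := by
  induction n with
  | zero => simp [stirlingPerms_zero, fap_nil]
  | succ n ih =>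
    rw [Function.iterate_succ_apply', ih,
      sum_fap_succ (fun a => ly ^ a * lz ^ (2 * (n + 1) - a)), Finset.mul_sum, Finset.mul_sum,
      map_sum]
    refine Finset.sum_congr rfl fun σ hσ => ?_
    obtain ⟨b, hb⟩ := Nat.exists_eq_add_of_le (fap_le_of_mem_stirlingPerms hσ)
    have hb' : (2 * (n : MvPowerSeries Letter ℚ) - fap σ) = b := by
      rw [sub_eq_iff_eq_add']
      rw [← Nat.cast_add, ← hb]
      push_cast
      rfl
    rw [formalDerivative_monomial, hb', show 2 * n - fap σ = b by omega,
      show 2 * (n + 1) - fap σ = b + 2 by omega, show 2 * (n + 1) - (fap σ + 1) = b + 1 by omega,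
      show 2 * (n + 1) - (fap σ + 2) = b by omega]

end FlagAscentPlateau

theorem mainTheorem1 (n : ℕ) (hn : 1 ≤ n) :
    (∀ σ ∈ FlagAscentPlateau.stirlingPerms n, FlagAscentPlateau.fap σ ≤ 2 * n) ∧
    (FlagAscentPlateau.formalDerivative FlagAscentPlateau.flagGrammar)^[n] FlagAscentPlateau.lx =
      FlagAscentPlateau.lx * ∑ σ ∈ FlagAscentPlateau.stirlingPerms n,
        FlagAscentPlateau.ly ^ FlagAscentPlateau.fap σ *
          FlagAscentPlateau.lz ^ (2 * n - FlagAscentPlateau.fap σ) ∧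
    FlagAscentPlateau.F n = ∑ k ∈ Finset.range (n + 1),
      (n.choose k : Polynomial ℚ) * FlagAscentPlateau.T k *
        (FlagAscentPlateau.M (n - k)).comp (Polynomial.X ^ 2) :=
  ⟨fun _ => FlagAscentPlateau.fap_le_of_mem_stirlingPerms,
    FlagAscentPlateau.iterate_formalDerivative_lx n, FlagAscentPlateau.F_eq_sum_choose n⟩
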